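/- Let $\mathbb{D}=\{z\in\mathbb{C}:|z|<1\}$, and let $\psi$ be analytic and univalent in $\mathbb{D}$ with $\psi(0)=1$ and $\operatorname{Re}\psi>0$ in $\mathbb{D}$. Let $\mathcal{S}^*(\psi)$ be the class of all analytic functions $h$ in $\mathbb{D}$ with $h(0)=0$, $h'(0)=1$ and $zh'(z)/h(z)\prec\psi(z)$, that is, $zh'(z)/h(z)=\psi(\omega(z))$ in $\mathbb{D}$ for some analytic $\omega:\mathbb{D}\to\mathbb{D}$ with $\omega(0)=0$ (the left side being $1$ at $z=0$). Let $r_c$ be the radius of convexity of $\mathcal{S}^*(\psi)$, i.e. the largest $r\le 1$ such that every $h\in\mathcal{S}^*(\psi)$ maps $|z|<r$ univalently onto a convex set. A domain $\Omega\subset\mathbb{C}$ is called close-to-convex if $\mathbb{C}\setminus\Omega$ is a union of closed half-lines whose corresponding open half-lines are pairwise disjoint. Theorem. Put $$H_\psi(r)=\inf\Big\{\operatorname{Re}\Big(1+\frac{zh''(z)}{h'(z)}\Big): |z|=r,\ h\in\mathcal{S}^*(\psi)\Big\},\qquad 0<r<1.$$ Then the equation $(1-r)H_\psi(r)-r=0$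 has a smallest root $r_0$ in $(0,1)$, and the following holds. If $h\in\mathcal{S}^*(\psi)$, $\varphi:\mathbb{D}\to\mathbb{D}$ is analytic, and $g$ is analytic in $\mathbb{D}$ with $g'=\varphi h'$, then the harmonic function $f=h+\overline{g}$ is univalent and close-to-convex in $|z|<\min\{r_0,r_c\}$; that is, $f$ is injective and sense-preserving (has positive Jacobian) in this disk and maps it onto a close-to-convex domain. Moreover, for each individual $h\in\mathcal{S}^*(\psi)$ the same is true with $H_\psi(r)$ replaced by $\min_{|z|=r}\operatorname{Re}\left(1+zh''(z)/h'(z)\right)$ for this $h$, and with $r_0$ replaced by the smallest root in $(0,1)$ of the corresponding equation. -/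

import Mathlib

open Set Metric

namespace MaMinda

/-- The open unit disk. -/
abbrev unitDisk : Set ℂ := ball 0 1

/-- `ψ` is analytic and univalent in the unit disk, `ψ(0) = 1`, and has positive real part. -/
structure IsMaMindaFunction (ψ : ℂ → ℂ) : Prop where
  analytic : DifferentiableOn ℂ ψ unitDisk
  univalent : InjOn ψ unitDisk
  map_zero : ψ 0 = 1
  re_pos : ∀ z ∈ unitDisk, 0 < (ψ z).re

/-- Subordination `F ≺ G` in the unit disk: `F = G ∘ ω` for an analytic self-map `ω` of the disk
with `ω(0) = 0`. -/
def Subordinate (F G : ℂ → ℂ) : Prop :=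
  ∃ ω : ℂ → ℂ, DifferentiableOn ℂ ω unitDisk ∧ MapsTo ω unitDisk unitDisk ∧ ω 0 = 0 ∧
    ∀ z ∈ unitDisk, F z = G (ω z)

/-- The class `𝒜`: analytic in the unit disk with `h(0) = 0`, `h'(0) = 1`. -/
def classA : Set (ℂ → ℂ) :=
  {h | DifferentiableOn ℂ h unitDisk ∧ h 0 = 0 ∧ deriv h 0 = 1}

/-- The function `z h'(z) / h(z)`, with its removable singularity at `0` filled in by the
value `1`, its limit there for `h ∈ 𝒜`. -/
noncomputable def starQuotient (h : ℂ → ℂ) : ℂ → ℂ :=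
  Function.update (fun z => z * deriv h z / h z) 0 1

/-- The class `𝒮*(ψ)` of functions `h ∈ 𝒜` with `z h'(z) / h(z) ≺ ψ(z)`. -/
def starlikeClass (ψ : ℂ → ℂ) : Set (ℂ → ℂ) :=
  {h | h ∈ classA ∧ Subordinate (starQuotient h) ψ}

/-- `h` is univalent in `|z| < r` and maps this disk onto a convex set. -/
def IsConvexUnivalentOn (h : ℂ → ℂ) (r : ℝ) : Prop :=
  InjOn h (ball 0 r) ∧ Convex ℝ (h '' ball 0 r)

/-- The radius of convexity of `𝒮*(ψ)`: the largest `r ≤ 1` such that all functions of the class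
are convex univalent in `|z| < r`. -/
noncomputable def radiusOfConvexity (ψ : ℂ → ℂ) : ℝ :=
  sSup {r | r ∈ Icc (0 : ℝ) 1 ∧ ∀ h ∈ starlikeClass ψ, IsConvexUnivalentOn h r}

/-- `Re (1 + z h''(z) / h'(z))`. -/
noncomputable def convexityRe (h : ℂ → ℂ) (z : ℂ) : ℝ :=
  (1 + z * deriv (deriv h) z / deriv h z).re

/-- `min_{|z| = r} Re (1 + z h''(z) / h'(z))` for one function `h`. -/
noncomputable def convexityMin (h : ℂ → ℂ) (r : ℝ) : ℝ :=
  sInf (convexityRe h '' sphere 0 r)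

/-- The sharp lower bound of `Re (1 + z h''(z) / h'(z))` over `|z| = r` and all `h ∈ 𝒮*(ψ)`. -/
noncomputable def classConvexityMin (ψ : ℂ → ℂ) (r : ℝ) : ℝ :=
  sInf {x | ∃ h ∈ starlikeClass ψ, ∃ z ∈ sphere (0 : ℂ) r, x = convexityRe h z}

/-- `r₀` is the smallest root in `(0, 1)` of `(1 - r) H(r) - r = 0`. -/
def IsMinimalRoot (H : ℝ → ℝ) (r₀ : ℝ) : Prop :=
  IsLeast {r : ℝ | r ∈ Ioo (0 : ℝ) 1 ∧ (1 - r) * H r - r = 0} r₀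

/-- The closed half-line from `a` in the direction `d`. -/
def closedHalfLine (a d : ℂ) : Set ℂ := (fun t : ℝ => a + t * d) '' Ici 0

/-- The open half-line from `a` in the direction `d`. -/
def openHalfLine (a d : ℂ) : Set ℂ := (fun t : ℝ => a + t * d) '' Ioi 0

/-- A close-to-convex domain: its complement is a union of closed half-lines whose corresponding
open half-lines are pairwise disjoint. Half-lines are given by origin and unit direction, so
distinct pairs are distinct half-lines. -/
def IsCloseToConvexDomain (Ω : Set ℂ) : Prop :=
  IsOpen Ω ∧ IsPreconnected Ω ∧
    ∃ S : Set (ℂ × ℂ), (∀ p ∈ S, ‖p.2‖ = 1) ∧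
      Ωᶜ = ⋃ p ∈ S, closedHalfLine p.1 p.2 ∧
      S.PairwiseDisjoint fun p => openHalfLine p.1 p.2

/-- `f` is a univalent, sense-preserving (positive Jacobian) harmonic mapping of `U` onto a
close-to-convex domain. -/
structure IsUnivalentCloseToConvexOn (f : ℂ → ℂ) (U : Set ℂ) : Prop where
  harmonic : InnerProductSpace.HarmonicOnNhd f U
  univalent : InjOn f U
  sense_preserving : ∀ z ∈ U, 0 < (fderiv ℝ f z).det
  closeToConvex : IsCloseToConvexDomain (f '' U)

end MaMinda

/-! On a disk `|z| < ρ` with `ρ < 1` where `h` is convex univalent, write `f = (id + T) ∘ h` with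
`T` the conjugate of `g ∘ h⁻¹`. The derivative of `g ∘ h⁻¹` at `h z` is `φ z`, and `|φ|` has a
maximum `k < 1` on the closed disk, so `T` is a `k`-contraction on the convex domain `Ω = h(|z| <
ρ)`. Everything then follows from a statement about contractions,
`Convex.exists_halfLines_compl_image_add_contraction`: extend `T` to the closure of `Ω` and
precompose with the metric projection `P`. The map `x ↦ x + T (P x)` is a homeomorphism of the whole
space, and as `P` is constant along each outer normal half-line of `Ω`, it translates these
half-lines rigidly. They cover the complement of `Ω` with disjoint open parts, hence so do their
images for the complement of `f(|z| < ρ)`.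

The radius `r₀` enters this argument only through `0 < r₀ < 1`; convexity comes from `r_c`. The
existence of `r₀` is a separate matter: the class is uniformly Lipschitz on smaller disks
(Borel–Carathéodory and Cauchy estimates for `zh'/h`), so `H` is continuous with value `1` at `0`,
while the minimum principle gives `H(1/2) ≤ 1`. Thus `(1 - r) H(r) - r` is positive near `0` and
nonpositive at `1/2`. -/

open Filter Topology NNReal

/-! ### Metric projections and contractive perturbations of convex domains -/

section ConvexProjection

variable {E : Type*} [NormedAddCommGroup E] [InnerProductSpace ℝ E]

/-- The metric projection onto a nonempty closed convex set, described by its variational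
inequality. -/
theorem Convex.exists_metricProjection [CompleteSpace E] {K : Set E} (hK : Convex ℝ K) (hc : IsClosed K)
    (hne : K.Nonempty) :
    ∃ P : E → E, (∀ x, P x ∈ K) ∧ (∀ x, ∀ w ∈ K, inner ℝ (x - P x) (w - P x) ≤ 0) := by
  choose P hP hP' using exists_norm_eq_iInf_of_complete_convex hne hc.isComplete hK
  exact ⟨P, hP, fun x => (norm_eq_iInf_iff_real_inner_le_zero hK (hP x)).1 (hP' x)⟩

/-- Points with the variational inequality of the metric projection depend on the projected point
in a `1`-Lipschitz way. -/
theorem norm_sub_le_of_inner_sub_nonpos {p q x y : E} (hp : inner ℝ (x - p) (q - p) ≤ 0)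
    (hq : inner ℝ (y - q) (p - q) ≤ 0) : ‖p - q‖ ≤ ‖x - y‖ := by
  have h1 : inner ℝ (p - q) (p - q) ≤ inner ℝ (x - y) (p - q) := by
    have e : inner ℝ (x - y) (p - q) - inner ℝ (p - q) (p - q)
        = -(inner ℝ (x - p) (q - p)) - inner ℝ (y - q) (p - q) := by
      simp only [inner_sub_left, inner_sub_right]; ring
    linarith
  rw [real_inner_self_eq_norm_mul_norm] at h1
  have h2 := real_inner_le_norm (x - y) (p - q)
  rcases (norm_nonneg (p - q)).eq_or_lt with h | h
  · rw [← h]; exact norm_nonneg _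
  · exact le_of_mul_le_mul_right (h1.trans h2) h

theorem eq_of_inner_sub_nonpos {p q x : E} (hp : inner ℝ (x - p) (q - p) ≤ 0)
    (hq : inner ℝ (x - q) (p - q) ≤ 0) : p = q := by
  have := norm_sub_le_of_inner_sub_nonpos hp hq
  simpa [sub_eq_zero] using this

/-- A Lipschitz map extends to the closure of its domain with the same constant. -/
theorem LipschitzOnWith.exists_extend_closure {X Y : Type*} [PseudoMetricSpace X]
    [MetricSpace Y] [CompleteSpace Y] {k : ℝ≥0} {T : X → Y} {s : Set X}
    (hT : LipschitzOnWith k T s) :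
    ∃ T' : X → Y, EqOn T' T s ∧ LipschitzOnWith k T' (closure s) := by
  have hlim : ∀ x ∈ closure s, ∃ y, Tendsto T (𝓝[s] x) (𝓝 y) := fun x hx => by
    have : (𝓝[s] x).NeBot := mem_closure_iff_nhdsWithin_neBot.1 hx
    apply cauchy_map_iff_exists_tendsto.1
    refine Metric.cauchy_iff.2 ⟨this.map T, fun ε hε => ?_⟩
    have hδ : 0 < ε / (2 * (k + 1)) := by positivity
    refine ⟨_, image_mem_map (inter_mem self_mem_nhdsWithin
      (mem_nhdsWithin_of_mem_nhds (ball_mem_nhds x hδ))), ?_⟩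
    rintro _ ⟨u, ⟨hu, hux⟩, rfl⟩ _ ⟨v, ⟨hv, hvx⟩, rfl⟩
    have huv : dist u v < ε / (k + 1) := by
      have h1 : dist u v ≤ dist u x + dist v x := dist_triangle_right u v x
      have h2 : ε / (k + 1 : ℝ) = ε / (2 * (k + 1)) + ε / (2 * (k + 1)) := by field_simp; norm_num
      rw [mem_ball] at hux hvx
      linarith
    calc dist (T u) (T v) ≤ k * dist u v := hT.dist_le_mul u hu v hv
      _ ≤ (k + 1) * dist u v := by gcongr; linarith
      _ < (k + 1) * (ε / (k + 1)) := by gcongr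
      _ = ε := by field_simp
  have heq : EqOn (extendFrom s T) T s := extendFrom_extends hT.continuousOn
  refine ⟨extendFrom s T, heq, LipschitzOnWith.closure (continuousOn_extendFrom subset_rfl hlim) ?_⟩
  intro x hx y hy
  rw [heq hx, heq hy]
  exact hT hx hy

/-- Existence of an outer normal at each point of the closure outside an open convex set. -/
theorem Convex.exists_unit_normal [CompleteSpace E] {Ω : Set E} (hΩ : Convex ℝ Ω) (ho : IsOpen Ω)
    (hne : Ω.Nonempty) {x : E} (hx : x ∉ Ω) :
    ∃ n : E, ‖n‖ = 1 ∧ ∀ v ∈ Ω, inner ℝ n (v - x) ≤ 0 := by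
  obtain ⟨f, hf⟩ := geometric_hahn_banach_open_point hΩ ho hx
  set m := (InnerProductSpace.toDual ℝ E).symm f with hm
  have hmi : ∀ v, inner ℝ m v = f v := fun v => by
    simp [hm]
  obtain ⟨a, ha⟩ := hne
  have hm0 : m ≠ 0 := fun h => by
    have := hf a ha
    rw [← hmi, ← hmi, h] at this
    simp at this
  refine ⟨‖m‖⁻¹ • m, by simp [norm_smul, hm0], fun v hv => ?_⟩
  rw [inner_smul_left, inner_sub_right, hmi, hmi]
  exact mul_nonpos_of_nonneg_of_nonpos (by simp) (by linarith [hf v hv])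

/-- The identity plus a contraction, on an open convex set `Ω`, has open image, whose complement is
the union of the translated normal half-lines of `Ω`; the corresponding open half-lines are pairwise
disjoint. -/
theorem Convex.exists_halfLines_compl_image_add_contraction [CompleteSpace E] {Ω : Set E} (hΩ : Convex ℝ Ω)
    (ho : IsOpen Ω) (hne : Ω.Nonempty) {T : E → E} {k : ℝ≥0} (hk : k < 1)
    (hT : LipschitzOnWith k T Ω) :
    InjOn (fun w => w + T w) Ω ∧ IsOpen ((fun w => w + T w) '' Ω) ∧
    ∃ S : Set (E × E), (∀ p ∈ S, ‖p.2‖ = 1) ∧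
      ((fun w => w + T w) '' Ω)ᶜ = ⋃ p ∈ S, (fun t : ℝ => p.1 + t • p.2) '' Ici 0 ∧
      S.PairwiseDisjoint fun p => (fun t : ℝ => p.1 + t • p.2) '' Ioi 0 := by
  obtain ⟨T', hT'eq, hT'⟩ := hT.exists_extend_closure
  obtain ⟨P, hPm, hPi⟩ := hΩ.closure.exists_metricProjection isClosed_closure hne.closure
  have hPl : ∀ x y, ‖P x - P y‖ ≤ ‖x - y‖ := fun x y =>
    norm_sub_le_of_inner_sub_nonpos (hPi x _ (hPm y)) (hPi y _ (hPm x))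
  have hPeq : ∀ p ∈ closure Ω, ∀ x, (∀ w ∈ closure Ω, inner ℝ (x - p) (w - p) ≤ 0) → P x = p :=
    fun p hp x h => eq_of_inner_sub_nonpos (hPi x _ hp) (h _ (hPm x))
  have hPself : ∀ p ∈ closure Ω, P p = p := fun p hp => hPeq p hp p (by simp)
  -- Since `P` is `1`-Lipschitz, `F - id` is `k`-Lipschitz on the whole space, which makes `F` a
  -- global homeomorphism.
  set F : E → E := fun x => x + T' (P x) with hF
  have hFl : LipschitzOnWith k (F - ⇑((ContinuousLinearEquiv.refl ℝ E : E ≃L[ℝ] E) : E →L[ℝ] E))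
      univ := by
    rw [lipschitzOnWith_iff_norm_sub_le]
    intro x _ y _
    simp only [hF, Pi.sub_apply, ContinuousLinearEquiv.coe_coe, ContinuousLinearEquiv.coe_refl',
      id, add_sub_cancel_left]
    exact (lipschitzOnWith_iff_norm_sub_le.1 hT' (hPm x) (hPm y)).trans
      (mul_le_mul_of_nonneg_left (hPl x y) k.2)
  have happ := hFl.approximatesLinearOn
  have hkN : Subsingleton E ∨
      k < ‖((ContinuousLinearEquiv.refl ℝ E).symm : E →L[ℝ] E)‖₊⁻¹ := by
    rcases subsingleton_or_nontrivial E with h | h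
    · exact Or.inl h
    · right
      have : ‖((ContinuousLinearEquiv.refl ℝ E).symm : E →L[ℝ] E)‖₊ = 1 := by
        rw [ContinuousLinearEquiv.refl_symm, ContinuousLinearEquiv.coe_refl]
        exact nnnorm_one
      rw [this]; simpa using hk
  let Φ : E ≃ₜ E := happ.toHomeomorph F hkN
  have hΦ : ∀ x, Φ x = F x := fun _ => rfl
  have hFΩ : EqOn (fun w => w + T w) Φ Ω := fun w hw => by
    simp only [hΦ, hF, hPself w (subset_closure hw), hT'eq hw]
  have himg : (fun w => w + T w) '' Ω = Φ '' Ω := hFΩ.image_eq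
  refine ⟨fun x hx y hy h => ?_, ?_, ?_⟩
  · rw [hFΩ hx, hFΩ hy] at h; exact Φ.injective h
  · rw [himg]; exact Φ.isOpenMap _ ho
  have hray : ∀ w ∈ closure Ω, ∀ n : E, (∀ v ∈ Ω, inner ℝ n (v - w) ≤ 0) → ∀ t : ℝ, 0 ≤ t →
      P (w + t • n) = w := fun w hw n hn t ht => by
    refine hPeq w hw _ fun v hv => ?_
    have hcl : IsClosed {v : E | inner ℝ n (v - w) ≤ 0} :=
      isClosed_le (by fun_prop) continuous_const
    have := (closure_minimal (t := {v : E | inner ℝ n (v - w) ≤ 0}) hn hcl) hv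
    rw [add_sub_cancel_left, inner_smul_left]
    exact mul_nonpos_of_nonneg_of_nonpos (by simpa using ht) this
  have hΦray : ∀ w ∈ closure Ω, ∀ n : E, (∀ v ∈ Ω, inner ℝ n (v - w) ≤ 0) → ∀ t : ℝ, 0 ≤ t →
      Φ (w + t • n) = w + T' w + t • n := fun w hw n hn t ht => by
    rw [hΦ, hF]
    simp only [hray w hw n hn t ht]
    abel
  -- All outer unit normals at `w` are taken, so a corner contributes a whole fan of half-lines.
  -- Points of the open set `Ω` have no such normal.
  refine ⟨{p | ∃ w ∈ closure Ω, ‖p.2‖ = 1 ∧ (∀ v ∈ Ω, inner ℝ p.2 (v - w) ≤ 0) ∧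
    p.1 = w + T' w}, fun p ⟨w, _, h, _⟩ => h, ?_, ?_⟩
  · rw [himg, ← Set.image_compl_eq Φ.bijective]
    ext y
    simp only [mem_image, mem_compl_iff, mem_iUnion, mem_ofPred_eq, exists_prop, Prod.exists]
    constructor
    · rintro ⟨x, hx, rfl⟩
      -- A boundary point is the origin of a supporting normal half-line; a point off the closure
      -- lies on the half-line from `P x` through it.
      by_cases hxc : x ∈ closure Ω
      · obtain ⟨n, hn1, hn⟩ := hΩ.exists_unit_normal ho hne hx
        refine ⟨x + T' x, n, ⟨x, hxc, hn1, hn, rfl⟩, 0, by simp, ?_⟩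
        rw [← hΦray x hxc n hn 0 le_rfl]; simp
      · have hxP : x - P x ≠ 0 := fun h => hxc (by rw [sub_eq_zero.1 h]; exact hPm x)
        have hn : ∀ v ∈ Ω, inner ℝ (‖x - P x‖⁻¹ • (x - P x)) (v - P x) ≤ 0 := fun v hv => by
          rw [inner_smul_left]
          exact mul_nonpos_of_nonneg_of_nonpos (by simp) (hPi x v (subset_closure hv))
        refine ⟨_, _, ⟨P x, hPm x, by simp [norm_smul, hxP], hn, rfl⟩, ‖x - P x‖, by simp, ?_⟩
        rw [← hΦray _ (hPm x) _ hn _ (norm_nonneg _), smul_smul,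
          mul_inv_cancel₀ (norm_ne_zero_iff.2 hxP), one_smul, add_sub_cancel]
    · rintro ⟨_, n, ⟨w, hw, hn1, hn, rfl⟩, t, ht, rfl⟩
      refine ⟨w + t • n, fun hmem => ?_, hΦray w hw n hn t ht⟩
      -- For `t = 0` the normal inequality is no contradiction by itself; openness allows a small
      -- extra step along `n`, which violates it strictly.
      have hcont : Tendsto (fun ε : ℝ => w + (t + ε) • n) (𝓝[>] 0) (𝓝 (w + t • n)) := by
        have : Continuous (fun ε : ℝ => w + (t + ε) • n) := by fun_prop
        simpa using (this.tendsto 0).mono_left nhdsWithin_le_nhds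
      obtain ⟨ε, hε, hε0⟩ := ((hcont.eventually (ho.mem_nhds hmem)).and
        self_mem_nhdsWithin).exists
      have := hn _ hε
      rw [add_sub_cancel_left, inner_smul_right, real_inner_self_eq_norm_sq, hn1] at this
      have hε0' : (0 : ℝ) < ε := hε0
      have ht' : (0 : ℝ) ≤ t := ht
      linarith
  · rintro ⟨_, n⟩ ⟨w, hw, hn1, hn, rfl⟩ ⟨_, n'⟩ ⟨w', hw', hn1', hn', rfl⟩ hpne
    refine Set.disjoint_left.2 ?_
    rintro y ⟨t, ht, rfl⟩ ⟨t', ht', h⟩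
    have ht0 : (0 : ℝ) < t := ht
    have ht0' : (0 : ℝ) < t' := ht'
    simp only at h hn hn' hn1 hn1'
    rw [← hΦray w hw n hn t ht0.le, ← hΦray w' hw' n' hn' t' ht0'.le] at h
    have h2 := Φ.injective h
    -- A common point determines the foot through `P`, then the parameter as a distance, then the
    -- direction, as the parameter is positive.
    have hww : w' = w := by
      rw [← hray w hw n hn t ht0.le, ← hray w' hw' n' hn' t' ht0'.le, h2]
    subst hww
    have h3 : t' • n' = t • n := add_left_cancel h2
    have h4 : t' = t := by
      have := congrArg norm h3
      simpa [norm_smul, hn1, hn1', abs_of_pos ht0, abs_of_pos ht0'] using this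
    subst h4
    have h5 : n' = n := smul_right_injective E ht0.ne' h3
    subst h5
    exact hpne rfl

end ConvexProjection

/-! ### Circular minima and the smallest root -/

namespace MaMinda

/-- The infimum over `|z| = r` of all functions of a family. -/
noncomputable def familyMin (𝓕 : Set (ℂ → ℝ)) (r : ℝ) : ℝ :=
  sInf {x | ∃ u ∈ 𝓕, ∃ z ∈ sphere (0 : ℂ) r, x = u z}

/-- Radial scaling by `s / r` carries one circle to the other and moves each point by `|s - r|`. The
value `s = 0` is allowed so that comparison with the origin bounds the minima from below. -/
theorem familyMin_le_familyMin_add {𝓕 : Set (ℂ → ℝ)} (hne : 𝓕.Nonempty) {R L : ℝ}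
    (h0 : ∀ u ∈ 𝓕, u 0 = 1)
    (hL : ∀ u ∈ 𝓕, ∀ z ∈ ball (0 : ℂ) R, ∀ w ∈ ball (0 : ℂ) R, |u z - u w| ≤ L * ‖z - w‖)
    {r s : ℝ} (hr : r ∈ Ioo 0 R) (hs : s ∈ Ico 0 R) :
    familyMin 𝓕 s ≤ familyMin 𝓕 r + L * |s - r| := by
  have hbdd : BddBelow {x | ∃ u ∈ 𝓕, ∃ z ∈ sphere (0 : ℂ) s, x = u z} := by
    refine ⟨1 - L * s, ?_⟩
    rintro _ ⟨u, hu, z, hz, rfl⟩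
    have hz' : ‖z‖ = s := by simpa using hz
    have := hL u hu z (by simpa [hz'] using hs.2) 0 (by simpa using hr.1.trans hr.2)
    rw [h0 u hu, sub_zero, hz'] at this
    linarith [(abs_le.1 this).1]
  obtain ⟨u₀, hu₀⟩ := hne
  have hne' : {x | ∃ u ∈ 𝓕, ∃ z ∈ sphere (0 : ℂ) r, x = u z}.Nonempty :=
    ⟨_, u₀, hu₀, (r : ℂ), by simp [abs_of_pos hr.1], rfl⟩
  rw [← sub_le_iff_le_add]
  refine le_csInf hne' ?_
  rintro _ ⟨u, hu, z, hz, rfl⟩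
  have hz' : ‖z‖ = r := by simpa using hz
  have hr0 : (r : ℂ) ≠ 0 := by exact_mod_cast hr.1.ne'
  have hn : ‖((s / r : ℝ) : ℂ) * z‖ = s := by
    rw [norm_mul, Complex.norm_real, hz', Real.norm_of_nonneg (div_nonneg hs.1 hr.1.le)]
    field_simp [hr.1.ne']
  have h1 : familyMin 𝓕 s ≤ u (((s / r : ℝ) : ℂ) * z) :=
    csInf_le hbdd ⟨u, hu, _, by simpa using hn, rfl⟩
  have h2 := hL u hu _ (by rw [mem_ball_zero_iff, hn]; exact hs.2 : ((s / r : ℝ) : ℂ) * z ∈ ball 0 R) z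
    (by simpa [hz'] using hr.2)
  have h3 : ‖((s / r : ℝ) : ℂ) * z - z‖ = |s - r| := by
    have : ((s / r : ℝ) : ℂ) * z - z = (((s - r) / r : ℝ) : ℂ) * z := by
      push_cast; field_simp
    rw [this, norm_mul, Complex.norm_real, hz', Real.norm_eq_abs, abs_div, abs_of_pos hr.1]
    field_simp [hr.1.ne']
  rw [h3] at h2
  linarith [(abs_le.1 h2).2]

/-- A family of functions equal to `1` at the origin, uniformly Lipschitz near each smaller disk and
with circular minima at most `1`, admits a smallest root of `(1 - r) H(r) = r`. -/
theorem exists_isMinimalRoot {𝓕 : Set (ℂ → ℝ)} (hne : 𝓕.Nonempty)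
    (h0 : ∀ u ∈ 𝓕, u 0 = 1) {R L : ℝ} (hR : 1 / 2 < R)
    (hL : ∀ u ∈ 𝓕, ∀ z ∈ ball (0 : ℂ) R, ∀ w ∈ ball (0 : ℂ) R, |u z - u w| ≤ L * ‖z - w‖)
    (hle : ∀ u ∈ 𝓕, ∃ z ∈ sphere (0 : ℂ) (1 / 2), u z ≤ 1) :
    ∃ r₀, IsMinimalRoot (familyMin 𝓕) r₀ := by
  obtain ⟨u₀, hu₀⟩ := id hne
  have hL0 : 0 ≤ L := by
    have h := (abs_nonneg _).trans (hL u₀ hu₀ ((1 / 2 : ℝ) : ℂ)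
      (by simpa [abs_of_pos] using hR) 0 (by simp; linarith))
    rw [sub_zero, Complex.norm_real, Real.norm_of_nonneg (by norm_num)] at h
    linarith
  have hlow : ∀ r ∈ Ioo 0 R, 1 - L * r ≤ familyMin 𝓕 r := fun r hr => by
    have := familyMin_le_familyMin_add hne h0 hL hr (s := 0) ⟨le_rfl, hr.1.trans hr.2⟩
    have h1 : familyMin 𝓕 0 = 1 := by
      have : {x | ∃ u ∈ 𝓕, ∃ z ∈ sphere (0 : ℂ) 0, x = u z} = {1} := by
        ext x
        simp only [sphere_zero, mem_singleton_iff, exists_eq_left, mem_ofPred_eq]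
        exact ⟨fun ⟨u, hu, hx⟩ => hx.trans (h0 u hu), fun hx => ⟨u₀, hu₀, hx.trans (h0 _ hu₀).symm⟩⟩
      rw [familyMin, this, csInf_singleton]
    rw [h1, zero_sub, abs_neg, abs_of_pos hr.1] at this
    linarith
  have hcont : ContinuousOn (familyMin 𝓕) (Ioo 0 R) := by
    refine LipschitzOnWith.continuousOn (K := ⟨L, hL0⟩) (LipschitzOnWith.of_dist_le_mul ?_)
    intro r hr s hs
    have h1 := familyMin_le_familyMin_add hne h0 hL hr (Ioo_subset_Ico_self hs)
    have h2 := familyMin_le_familyMin_add hne h0 hL hs (Ioo_subset_Ico_self hr)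
    rw [abs_sub_comm] at h1
    rw [Real.dist_eq, Real.dist_eq, abs_le]
    change -(L * |r - s|) ≤ _ ∧ _ ≤ L * |r - s|
    constructor <;> linarith
  have hhalf : familyMin 𝓕 (1 / 2) ≤ 1 := by
    obtain ⟨z, hz, hzu⟩ := hle u₀ hu₀
    have hbdd : BddBelow {x | ∃ u ∈ 𝓕, ∃ z ∈ sphere (0 : ℂ) (1 / 2), x = u z} := by
      refine ⟨1 - L * (1 / 2), ?_⟩
      rintro _ ⟨u, hu, z, hz, rfl⟩
      have hz' : ‖z‖ = 1 / 2 := by simpa using hz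
      have := hL u hu z (by simpa [hz'] using hR) 0 (by simp; linarith)
      rw [h0 u hu, sub_zero, hz'] at this
      linarith [(abs_le.1 this).1]
    exact (csInf_le hbdd ⟨u₀, hu₀, z, hz, rfl⟩).trans hzu
  set D : ℝ → ℝ := fun r => (1 - r) * familyMin 𝓕 r - r with hD
  -- For `r ≤ ε`, `(1 - r)(1 - L r) - r ≥ 1 - (L + 2) r ≥ 1/2`, so there is no root in `(0, ε]`.
  set ε : ℝ := 1 / (2 * (L + 2)) with hε
  have hε0 : 0 < ε := by positivity
  have hεL : (L + 2) * ε = 1 / 2 := by rw [hε]; field_simp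
  have hε2 : ε < 1 / 2 := by nlinarith
  have hDpos : ∀ r, 0 < r → r ≤ ε → 0 < D r := fun r hr hrε => by
    have h1 := hlow r ⟨hr, by linarith⟩
    have h2 : (1 - r) * (1 - L * r) ≤ (1 - r) * familyMin 𝓕 r :=
      mul_le_mul_of_nonneg_left h1 (by linarith)
    have h3 : (L + 2) * r ≤ 1 / 2 := hεL ▸ mul_le_mul_of_nonneg_left hrε (by linarith)
    have h4 : 0 ≤ L * r * r := by positivity
    simp only [hD]
    nlinarith
  have hDc : ContinuousOn D (Icc ε (1 / 2)) := by
    have : ContinuousOn (familyMin 𝓕) (Icc ε (1 / 2)) :=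
      hcont.mono fun r hr => ⟨hε0.trans_le hr.1, hr.2.trans_lt hR⟩
    exact ((continuousOn_const.sub continuousOn_id).mul this).sub continuousOn_id
  have hcomp : IsCompact (Icc ε (1 / 2) ∩ D ⁻¹' {0}) :=
    isCompact_Icc.of_isClosed_subset (hDc.preimage_isClosed_of_isClosed isClosed_Icc
      isClosed_singleton) inter_subset_left
  have hnonempty : (Icc ε (1 / 2) ∩ D ⁻¹' {0}).Nonempty := by
    obtain ⟨r, hr, hr0⟩ := intermediate_value_Icc' hε2.le hDc
      (show (0 : ℝ) ∈ Icc (D (1 / 2)) (D ε) from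
        ⟨by simp only [hD]; linarith, (hDpos ε hε0 le_rfl).le⟩)
    exact ⟨r, hr, hr0⟩
  obtain ⟨r₀, ⟨hr₀, hr₀D⟩, hmin⟩ := hcomp.exists_isLeast hnonempty
  refine ⟨r₀, ⟨⟨hε0.trans_le hr₀.1, by linarith [hr₀.2]⟩, hr₀D⟩, ?_⟩
  rintro r ⟨hr, hrD⟩
  rcases le_total r (1 / 2) with h | h
  · refine hmin ⟨⟨?_, h⟩, hrD⟩
    by_contra hlt
    exact (hDpos r hr.1 (not_le.1 hlt).le).ne' hrD
  · exact hr₀.2.trans h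

end MaMinda

/-! ### Uniform estimates for the class and existence of the root -/

theorem Complex.norm_deriv_le_of_norm_le_ball {f : ℂ → ℂ} {R S M : ℝ} (hRS : R < S)
    (hf : DifferentiableOn ℂ f (ball 0 S)) (hM : ∀ z ∈ ball (0 : ℂ) S, ‖f z‖ ≤ M) {z : ℂ}
    (hz : z ∈ ball (0 : ℂ) R) : ‖deriv f z‖ ≤ M / ((S - R) / 2) := by
  have hsub : closedBall z ((S - R) / 2) ⊆ ball 0 S := fun w hw => by
    have h1 := dist_triangle w z 0
    rw [mem_closedBall] at hw
    rw [mem_ball] at hz ⊢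
    linarith
  have hpos : 0 < (S - R) / 2 := by linarith
  exact norm_deriv_le_of_forall_mem_sphere_norm_le hpos (hf.diffContOnCl_ball hsub)
    fun w hw => hM w (hsub (sphere_subset_closedBall hw))

/-- A growth bound for functions of positive real part. -/
theorem Complex.norm_le_of_re_pos {p : ℂ → ℂ} (hp : DifferentiableOn ℂ p (ball 0 1))
    (hre : ∀ z ∈ ball (0 : ℂ) 1, 0 < (p z).re) (h0 : p 0 = 1) {R : ℝ} (hR : R < 1) {z : ℂ}
    (hz : z ∈ ball (0 : ℂ) R) : ‖p z‖ ≤ 4 / (1 - R) := by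
  have hzR : ‖z‖ < R := by simpa using hz
  have hz1 : z ∈ ball (0 : ℂ) 1 := ball_subset_ball hR.le hz
  have h := borelCaratheodory (f := fun z => -p z) (M := 1) (R := 1) one_pos hp.neg
    (fun w hw => by simpa using (by linarith [hre w hw] : -(p w).re ≤ 1)) one_pos hz1
  simp only [norm_neg, h0, norm_one] at h
  have : 2 * 1 * ‖z‖ / (1 - ‖z‖) + 1 * (1 + ‖z‖) / (1 - ‖z‖) = (1 + 3 * ‖z‖) / (1 - ‖z‖) := by
    rw [← add_div]; ring
  rw [this] at h
  refine h.trans (div_le_div₀ (by norm_num) (by linarith) (by linarith) (by linarith))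

namespace MaMinda

variable {ψ h : ℂ → ℂ}

/-- The quotient `z h' / h` of a function of the class is analytic, of positive real part. -/
theorem starQuotient_props (hψ : IsMaMindaFunction ψ) (hh : h ∈ starlikeClass ψ) :
    DifferentiableOn ℂ (starQuotient h) unitDisk ∧
      (∀ z ∈ unitDisk, 0 < (starQuotient h z).re) ∧ starQuotient h 0 = 1 := by
  obtain ⟨_, ω, hω, hm, -, he⟩ := hh
  exact ⟨(hψ.analytic.comp hω hm).congr he, fun z hz => by rw [he z hz]; exact hψ.re_pos _ (hm hz),
    by simp [starQuotient]⟩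

theorem starQuotient_of_ne {z : ℂ} (hz : z ≠ 0) : starQuotient h z = z * deriv h z / h z := by
  simp [starQuotient, hz]

theorem apply_ne_zero_of_mem (hψ : IsMaMindaFunction ψ) (hh : h ∈ starlikeClass ψ) {z : ℂ}
    (hz : z ∈ unitDisk) (hz0 : z ≠ 0) : h z ≠ 0 := fun h0 => by
  have := (starQuotient_props hψ hh).2.1 z hz
  rw [starQuotient_of_ne hz0, h0] at this
  simp at this

theorem deriv_ne_zero_of_mem (hψ : IsMaMindaFunction ψ) (hh : h ∈ starlikeClass ψ) {z : ℂ}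
    (hz : z ∈ unitDisk) : deriv h z ≠ 0 := fun h0 => by
  rcases eq_or_ne z 0 with rfl | hz0
  · rw [hh.1.2.2] at h0; exact one_ne_zero h0
  · have := (starQuotient_props hψ hh).2.1 z hz
    rw [starQuotient_of_ne hz0, h0] at this
    simp at this

/-- Logarithmic differentiation of `z h' / h`. It reduces estimates on `h''` to a function of
positive real part. -/
theorem one_add_eq_starQuotient_add (hψ : IsMaMindaFunction ψ) (hh : h ∈ starlikeClass ψ) {z : ℂ}
    (hz : z ∈ unitDisk) :
    1 + z * deriv (deriv h) z / deriv h z =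
      starQuotient h z + z * deriv (starQuotient h) z / starQuotient h z := by
  rcases eq_or_ne z 0 with rfl | hz0
  · simp [starQuotient]
  have hd := hh.1.1
  have hz1 := isOpen_ball.mem_nhds hz
  have h1 : HasDerivAt h (deriv h z) z := (hd.differentiableAt hz1).hasDerivAt
  have h2 : HasDerivAt (deriv h) (deriv (deriv h) z) z :=
    ((hd.deriv isOpen_ball).differentiableAt hz1).hasDerivAt
  have hn := apply_ne_zero_of_mem hψ hh hz hz0
  have hn' := deriv_ne_zero_of_mem hψ hh hz
  have h3 := ((hasDerivAt_id z).mul h2).div h1 hn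
  have h4 : starQuotient h =ᶠ[𝓝 z] fun z => z * deriv h z / h z := by
    filter_upwards [isOpen_ne.mem_nhds hz0] with w hw using starQuotient_of_ne hw
  have h5 := (h3.congr_of_eventuallyEq h4).deriv
  rw [h5, starQuotient_of_ne hz0]
  simp only [id, Pi.mul_apply]
  field_simp
  ring

theorem differentiableOn_convexity (hψ : IsMaMindaFunction ψ) (hh : h ∈ starlikeClass ψ) :
    DifferentiableOn ℂ (fun z => 1 + z * deriv (deriv h) z / deriv h z) unitDisk := by
  have h1 := hh.1.1.deriv isOpen_ball
  have h2 := h1.deriv isOpen_ball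
  exact ((differentiableOn_id.mul h2).div h1 fun z hz => deriv_ne_zero_of_mem hψ hh hz).const_add 1

/-- Uniform bound for `1 + z h'' / h'` over the class. -/
theorem exists_norm_convexity_le (hψ : IsMaMindaFunction ψ) {R : ℝ} (hR : R < 1) :
    ∃ M : ℝ, ∀ h ∈ starlikeClass ψ, ∀ z ∈ ball (0 : ℂ) R,
      ‖1 + z * deriv (deriv h) z / deriv h z‖ ≤ M := by
  -- With `p = zh'/h`, the terms bound `p`, `p'` (Cauchy, from the disk of radius `(R + 1) / 2`) and
  -- `1/p`, which also has positive real part.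
  refine ⟨4 / (1 - R) + 4 / (1 - (R + 1) / 2) / (((R + 1) / 2 - R) / 2) * (4 / (1 - R)),
    fun h hh z hz => ?_⟩
  obtain ⟨hp, hre, h0⟩ := starQuotient_props hψ hh
  have hz1 : z ∈ unitDisk := ball_subset_ball hR.le hz
  rw [one_add_eq_starQuotient_add hψ hh hz1]
  have hb := Complex.norm_le_of_re_pos hp hre h0 hR hz
  have hne : ∀ z ∈ unitDisk, starQuotient h z ≠ 0 := fun z hz h0 => by
    have := hre z hz; rw [h0] at this; simp at this
  have hbi : ‖(starQuotient h z)⁻¹‖ ≤ 4 / (1 - R) := by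
    refine Complex.norm_le_of_re_pos (p := fun z => (starQuotient h z)⁻¹) (hp.inv hne)
      (fun w hw => ?_) (by simp [h0]) hR hz
    rw [Complex.inv_re]
    exact div_pos (hre w hw) (Complex.normSq_pos.2 (hne w hw))
  have hd := Complex.norm_deriv_le_of_norm_le_ball (R := R) (S := (R + 1) / 2) (by linarith)
    (hp.mono (ball_subset_ball (by linarith)))
    (fun w hw => Complex.norm_le_of_re_pos hp hre h0 (by linarith) hw) hz
  have hz' : ‖z‖ ≤ 1 := (mem_ball_zero_iff.1 hz1).le
  refine (norm_add_le _ _).trans (add_le_add hb ?_)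
  rw [div_eq_mul_inv, norm_mul, norm_mul]
  refine mul_le_mul ?_ hbi (norm_nonneg _) ((norm_nonneg _).trans hd)
  calc ‖z‖ * ‖deriv (starQuotient h) z‖ ≤ 1 * ‖deriv (starQuotient h) z‖ := by gcongr
    _ ≤ _ := by rw [one_mul]; exact hd

/-- The functions `convexityRe h` are uniformly Lipschitz on smaller disks. -/
theorem exists_lipschitz_convexityRe (hψ : IsMaMindaFunction ψ) {R : ℝ} (hR : R < 1) :
    ∃ L : ℝ, ∀ h ∈ starlikeClass ψ, ∀ z ∈ ball (0 : ℂ) R, ∀ w ∈ ball (0 : ℂ) R,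
      |convexityRe h z - convexityRe h w| ≤ L * ‖z - w‖ := by
  have hS : (R + 1) / 2 < 1 := by linarith
  obtain ⟨M, hM⟩ := exists_norm_convexity_le hψ hS
  refine ⟨M / (((R + 1) / 2 - R) / 2), fun h hh z hz w hw => ?_⟩
  have hd := differentiableOn_convexity hψ hh
  have h1 := fun z hz => Complex.norm_deriv_le_of_norm_le_ball (z := z)
    (R := R) (S := (R + 1) / 2) (by linarith) (hd.mono (ball_subset_ball hS.le)) (hM h hh) hz
  have h2 := (convex_ball (0 : ℂ) R).norm_image_sub_le_of_norm_deriv_le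
    (fun x hx => hd.differentiableAt (isOpen_ball.mem_nhds (ball_subset_ball hR.le hx))) h1 hw hz
  rw [convexityRe, convexityRe, ← Complex.sub_re]
  exact (Complex.abs_re_le_norm _).trans h2

/-- Minimum principle for `convexityRe`. -/
theorem exists_convexityRe_le_one (hψ : IsMaMindaFunction ψ) (hh : h ∈ starlikeClass ψ) {r : ℝ}
    (hr : r ∈ Ioo 0 1) : ∃ z ∈ sphere (0 : ℂ) r, convexityRe h z ≤ 1 := by
  by_contra! hcon
  set q : ℂ → ℂ := fun z => 1 + z * deriv (deriv h) z / deriv h z with hq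
  have hd : DifferentiableOn ℂ q (closedBall 0 r) :=
    (differentiableOn_convexity hψ hh).mono (closedBall_subset_ball hr.2)
  have hne : (sphere (0 : ℂ) r).Nonempty := NormedSpace.sphere_nonempty.2 hr.1.le
  obtain ⟨z₀, hz₀, hmin⟩ := (isCompact_sphere (0 : ℂ) r).exists_isMinOn hne
    (Complex.continuous_re.comp_continuousOn (hd.continuousOn.mono sphere_subset_closedBall))
  -- The maximum modulus principle for `exp (-q)` is the minimum principle for `Re q`; at the centre
  -- `q = 1`.
  have hE : DifferentiableOn ℂ (fun z => Complex.exp (-q z)) (closedBall 0 r) := hd.neg.cexp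
  have := Complex.norm_le_of_forall_mem_frontier_norm_le isBounded_ball
    (hE.diffContOnCl_ball (c := 0) (R := r) subset_rfl) (C := Real.exp (-(q z₀).re))
    (fun z hz => by
      rw [frontier_ball _ hr.1.ne'] at hz
      rw [Complex.norm_exp, Complex.neg_re, Real.exp_le_exp, neg_le_neg_iff]
      exact hmin hz) (subset_closure (mem_ball_self hr.1))
  rw [Complex.norm_exp, Complex.neg_re, Real.exp_le_exp, neg_le_neg_iff] at this
  have h1 : (1 : ℝ) < (q z₀).re := hcon z₀ hz₀
  simp only [hq, zero_mul, zero_div, add_zero, Complex.one_re] at this h1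
  linarith

theorem id_mem_starlikeClass (hψ : IsMaMindaFunction ψ) : (fun z => z) ∈ starlikeClass ψ := by
  refine ⟨⟨differentiableOn_id, rfl, by simp⟩, fun _ => 0, differentiableOn_const _,
    fun _ _ => by simp, rfl, fun z _ => ?_⟩
  rw [hψ.map_zero]
  rcases eq_or_ne z 0 with rfl | hz
  · simp [starQuotient]
  · rw [starQuotient_of_ne hz]; simp [hz]

/-- Applied to the whole class and to a singleton, this serves both halves of the theorem. -/
theorem exists_isMinimalRoot_of_subset (hψ : IsMaMindaFunction ψ) {𝓗 : Set (ℂ → ℂ)}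
    (hsub : 𝓗 ⊆ starlikeClass ψ) (hne : 𝓗.Nonempty) :
    ∃ r₀, IsMinimalRoot (familyMin (convexityRe '' 𝓗)) r₀ := by
  obtain ⟨L, hL⟩ := exists_lipschitz_convexityRe hψ (R := 3 / 4) (by norm_num)
  refine exists_isMinimalRoot (hne.image _) ?_ (R := 3 / 4) (L := L) (by norm_num) ?_ ?_
  · rintro _ ⟨h, -, rfl⟩
    simp [convexityRe]
  · rintro _ ⟨h, hh, rfl⟩
    exact hL h (hsub hh)
  · rintro _ ⟨h, hh, rfl⟩
    exact exists_convexityRe_le_one hψ (hsub hh) (by norm_num)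

theorem exists_isMinimalRoot_classConvexityMin (hψ : IsMaMindaFunction ψ) :
    ∃ r₀, IsMinimalRoot (classConvexityMin ψ) r₀ := by
  have h := exists_isMinimalRoot_of_subset hψ subset_rfl ⟨_, id_mem_starlikeClass hψ⟩
  have e : classConvexityMin ψ = familyMin (convexityRe '' starlikeClass ψ) := by
    ext r
    simp [classConvexityMin, familyMin]
  rwa [e]

theorem exists_isMinimalRoot_convexityMin (hψ : IsMaMindaFunction ψ) (hh : h ∈ starlikeClass ψ) :
    ∃ r₀, IsMinimalRoot (convexityMin h) r₀ := by
  have H := exists_isMinimalRoot_of_subset hψ (singleton_subset_iff.2 hh) ⟨_, rfl⟩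
  have e : convexityMin h = familyMin (convexityRe '' {h}) := by
    ext r
    rw [convexityMin, familyMin]
    congr 1
    ext x
    simp [eq_comm]
  rwa [e]

end MaMinda

/-! ### Inverses and convexity on smaller disks -/

/-- The inverse of an injective analytic function without critical points. -/
theorem hasDerivAt_invFunOn {h : ℂ → ℂ} {U : Set ℂ} (hU : IsOpen U) (hd : DifferentiableOn ℂ h U)
    (hi : InjOn h U) {z : ℂ} (hz : z ∈ U) (hne : deriv h z ≠ 0) :
    HasDerivAt (Function.invFunOn h U) (deriv h z)⁻¹ (h z) := by
  have hinv : ∀ w ∈ U, Function.invFunOn h U (h w) = w := fun w hw => hi.leftInvOn_invFunOn hw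
  have hst : HasStrictDerivAt h (deriv h z) z :=
    (hd.analyticAt (hU.mem_nhds hz)).hasStrictDerivAt
  have hmap := hst.map_nhds_eq hne
  have hzz : Function.invFunOn h U (h z) = z := hinv z hz
  have hc : ContinuousAt (Function.invFunOn h U) (h z) := by
    rw [ContinuousAt, hzz, ← hmap, tendsto_map'_iff]
    refine tendsto_id.congr' ?_
    filter_upwards [hU.mem_nhds hz] with w hw using (hinv w hw).symm
  have hd' : HasDerivAt h (deriv h z) (Function.invFunOn h U (h z)) := by
    rw [hzz]; exact hst.hasDerivAt
  refine hd'.of_local_left_inverse hc hne ?_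
  rw [← hmap]
  change ∀ᶠ w in 𝓝 z, _
  filter_upwards [hU.mem_nhds hz] with w hw
  rw [hinv w hw]

/-- A convex univalent function maps every concentric smaller disk onto a convex set. -/
theorem Convex.image_ball_of_le {h : ℂ → ℂ} {r R : ℝ} (hrR : r ≤ R)
    (hd : DifferentiableOn ℂ h (ball 0 R)) (hi : InjOn h (ball 0 R))
    (hne : ∀ z ∈ ball (0 : ℂ) R, deriv h z ≠ 0) (hc : Convex ℝ (h '' ball 0 R)) :
    Convex ℝ (h '' ball 0 r) := by
  have key : ∀ z₁ z₂ : ℂ, ‖z₁‖ ≤ ‖z₂‖ → z₂ ∈ ball (0 : ℂ) r → ∀ a b : ℝ, 0 ≤ a → 0 ≤ b →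
      a + b = 1 → a • h z₁ + b • h z₂ ∈ h '' ball 0 r := by
    intro z₁ z₂ hle hz₂ a b ha hb hab
    rcases eq_or_ne z₂ 0 with rfl | hz0
    · have : z₁ = 0 := by simpa using hle
      subst this
      rw [← add_smul, hab, one_smul]
      exact mem_image_of_mem _ hz₂
    have hm : MapsTo (fun z => z * (z₁ / z₂)) (ball (0 : ℂ) R) (ball 0 R) := fun z hz => by
      rw [mem_ball_zero_iff] at hz ⊢
      have h1 : ‖z₁ / z₂‖ ≤ 1 := by
        rw [norm_div]; exact div_le_one_of_le₀ hle (norm_nonneg _)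
      rw [norm_mul]
      exact (mul_le_of_le_one_right (norm_nonneg _) h1).trans_lt hz
    -- Convexity keeps `u` inside the image of `h`, and `u 0 = h 0`. The Schwarz lemma for `h⁻¹ ∘ u`
    -- at `z₂`, where `u` is the given convex combination, yields a preimage of modulus at most
    -- `|z₂| < r`.
    set u : ℂ → ℂ := fun z => a • h (z * (z₁ / z₂)) + b • h z with hu
    have hum : MapsTo u (ball 0 R) (h '' ball 0 R) := fun z hz =>
      hc (mem_image_of_mem _ (hm hz)) (mem_image_of_mem _ hz) ha hb hab
    have hud : DifferentiableOn ℂ u (ball 0 R) :=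
      ((hd.comp (by fun_prop) hm).const_smul a).add (hd.const_smul b)
    set v := Function.invFunOn h (ball 0 R) with hv
    have hvd : DifferentiableOn ℂ v (h '' ball 0 R) := by
      rintro _ ⟨z, hz, rfl⟩
      exact (hasDerivAt_invFunOn isOpen_ball hd hi hz (hne z hz)).differentiableAt
        |>.differentiableWithinAt
    have hvm : MapsTo v (h '' ball 0 R) (ball 0 R) := fun w hw => Function.invFunOn_mem hw
    have hR : 0 < R := (norm_nonneg z₂).trans_lt ((mem_ball_zero_iff.1 hz₂).trans_le hrR)
    have h0 : (v ∘ u) 0 = 0 := by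
      have : u 0 = h 0 := by
        simp only [hu, zero_mul]
        rw [← add_smul, hab, one_smul]
      rw [Function.comp_apply, this]
      exact hi.leftInvOn_invFunOn (mem_ball_self hR)
    have hz₂R : ‖z₂‖ < R := (mem_ball_zero_iff.1 hz₂).trans_le hrR
    have hs := Complex.norm_le_norm_of_mapsTo_ball (hvd.comp hud hum)
      ((hvm.comp hum).mono_right ball_subset_closedBall) h0 hz₂R
    refine ⟨v (u z₂), mem_ball_zero_iff.2 (hs.trans_lt (mem_ball_zero_iff.1 hz₂)), ?_⟩
    rw [Function.invFunOn_eq (hum (mem_ball_zero_iff.2 hz₂R))]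
    simp only [hu]
    rw [mul_div_cancel₀ _ hz0]
  rintro _ ⟨z₁, hz₁, rfl⟩ _ ⟨z₂, hz₂, rfl⟩ a b ha hb hab
  rcases le_total ‖z₁‖ ‖z₂‖ with h | h
  · exact key z₁ z₂ h hz₂ a b ha hb hab
  · rw [add_comm]
    exact key z₂ z₁ h hz₁ b a hb ha (by rw [add_comm, hab])

/-! ### The harmonic mapping `h + conj g` -/

theorem Complex.det_continuousLinearMap (L : ℂ →L[ℝ] ℂ) :
    L.det = (L 1).re * (L I).im - (L I).re * (L 1).im := by
  rw [ContinuousLinearMap.det, ← LinearMap.det_toMatrix basisOneI, Matrix.det_fin_two]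
  simp [LinearMap.toMatrix_apply]

/-- The Jacobian of `h + conj g`. -/
theorem Complex.det_fderiv_add_conj {h g : ℂ → ℂ} {z : ℂ} (hh : DifferentiableAt ℂ h z)
    (hg : DifferentiableAt ℂ g z) :
    (fderiv ℝ (fun z => h z + (starRingEnd ℂ) (g z)) z).det =
      ‖deriv h z‖ ^ 2 - ‖deriv g z‖ ^ 2 := by
  have h1 : HasFDerivAt h ((deriv h z) • (1 : ℂ →L[ℝ] ℂ)) z :=
    hh.hasDerivAt.complexToReal_fderiv
  have h2 : HasFDerivAt g ((deriv g z) • (1 : ℂ →L[ℝ] ℂ)) z :=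
    hg.hasDerivAt.complexToReal_fderiv
  have h3 := h1.add (conjCLE.toContinuousLinearMap.hasFDerivAt.comp z h2)
  have h4 : fderiv ℝ (fun z => h z + (starRingEnd ℂ) (g z)) z = _ := h3.fderiv
  rw [h4, det_continuousLinearMap, ← normSq_eq_norm_sq, ← normSq_eq_norm_sq, normSq_apply,
    normSq_apply]
  simp
  ring

namespace MaMinda

variable {ψ h : ℂ → ℂ}

/-- Needed for the degenerate disk of radius `0`. The plane is filled by the vertical half-lines
going up and down from the real axis. -/
theorem isCloseToConvexDomain_empty : IsCloseToConvexDomain ∅ := by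
  refine ⟨isOpen_empty, isPreconnected_empty,
    {p | p.1.im = 0 ∧ (p.2 = Complex.I ∨ p.2 = -Complex.I)}, ?_, ?_, ?_⟩
  · rintro ⟨a, d⟩ ⟨-, rfl | rfl⟩ <;> simp
  · rw [compl_empty, eq_comm, eq_univ_iff_forall]
    intro z
    simp only [mem_iUnion, exists_prop, Prod.exists, mem_ofPred_eq, closedHalfLine, mem_image]
    rcases le_total 0 z.im with hz | hz
    · exact ⟨z.re, Complex.I, ⟨by simp, Or.inl rfl⟩, z.im, hz, Complex.re_add_im z⟩
    · refine ⟨z.re, -Complex.I, ⟨by simp, Or.inr rfl⟩, -z.im, by simpa using hz, ?_⟩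
      rw [Complex.ofReal_neg, neg_mul_neg]; exact Complex.re_add_im z
  · rintro ⟨a, d⟩ ⟨ha, hd⟩ ⟨a', d'⟩ ⟨ha', hd'⟩ hne
    refine Set.disjoint_left.2 ?_
    rintro _ ⟨t, ht, rfl⟩ ⟨t', ht', he⟩
    have ht0 : (0 : ℝ) < t := ht
    have ht0' : (0 : ℝ) < t' := ht'
    simp only at ha ha' hd hd'
    have hre := congrArg Complex.re he
    have him := congrArg Complex.im he
    refine hne (Prod.ext (Complex.ext ?_ (ha.trans ha'.symm)) ?_)
    · rcases hd with rfl | rfl <;> rcases hd' with rfl | rfl <;> simpa using hre.symm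
    · rcases hd with rfl | rfl <;> rcases hd' with rfl | rfl <;>
        first
        | rfl
        | (exfalso; simp [ha, ha'] at him; linarith)

theorem harmonicOnNhd_add_conj {g : ℂ → ℂ} {U : Set ℂ} (hU : IsOpen U)
    (hh : DifferentiableOn ℂ h U) (hg : DifferentiableOn ℂ g U) :
    InnerProductSpace.HarmonicOnNhd (fun z => h z + (starRingEnd ℂ) (g z)) U := by
  intro z hz
  have h1 := (hh.analyticAt (hU.mem_nhds hz)).harmonicAt
  have h2 := (hg.analyticAt (hU.mem_nhds hz)).harmonicAt
  exact h1.add (h2.comp_CLM Complex.conjCLE.toContinuousLinearMap)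

/-- The supremum is attained: radii below it inherit convexity by `Convex.image_ball_of_le`, and any
two points of the open disk lie in a common smaller one. -/
theorem isConvexUnivalentOn_of_le_radiusOfConvexity (hψ : IsMaMindaFunction ψ)
    (hh : h ∈ starlikeClass ψ) {ρ : ℝ} (hρ : ρ ≤ radiusOfConvexity ψ) :
    IsConvexUnivalentOn h ρ := by
  set A := {r | r ∈ Icc (0 : ℝ) 1 ∧ ∀ h ∈ starlikeClass ψ, IsConvexUnivalentOn h r} with hA
  have hAne : A.Nonempty := ⟨0, by simp, fun h _ => by
    simp [IsConvexUnivalentOn, convex_empty]⟩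
  have hlt : ∀ r < ρ, IsConvexUnivalentOn h r := fun r hr => by
    obtain ⟨r', hr', hrr'⟩ := exists_lt_of_lt_csSup hAne (hr.trans_le hρ)
    obtain ⟨hi, hc⟩ := hr'.2 h hh
    have hsub : ball (0 : ℂ) r' ⊆ unitDisk := ball_subset_ball hr'.1.2
    exact ⟨hi.mono (ball_subset_ball hrr'.le), hc.image_ball_of_le hrr'.le (hh.1.1.mono hsub) hi
      fun z hz => deriv_ne_zero_of_mem hψ hh (hsub hz)⟩
  have hcommon : ∀ z ∈ ball (0 : ℂ) ρ, ∀ w ∈ ball (0 : ℂ) ρ,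
      ∃ r < ρ, z ∈ ball (0 : ℂ) r ∧ w ∈ ball (0 : ℂ) r := fun z hz w hw => by
    simp only [mem_ball_zero_iff] at hz hw ⊢
    obtain ⟨r, hr, hr'⟩ := exists_between (max_lt hz hw)
    exact ⟨r, hr', (le_max_left _ _).trans_lt hr, (le_max_right _ _).trans_lt hr⟩
  constructor
  · intro z hz w hw hzw
    obtain ⟨r, hr, hzr, hwr⟩ := hcommon z hz w hw
    exact (hlt r hr).1 hzr hwr hzw
  · rintro _ ⟨z, hz, rfl⟩ _ ⟨w, hw, rfl⟩ a b ha hb hab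
    obtain ⟨r, hr, hzr, hwr⟩ := hcommon z hz w hw
    exact image_mono (ball_subset_ball hr.le)
      ((hlt r hr).2 (mem_image_of_mem _ hzr) (mem_image_of_mem _ hwr) ha hb hab)

theorem radiusOfConvexity_nonneg : 0 ≤ radiusOfConvexity ψ :=
  Real.sSup_nonneg fun _ hr => hr.1.1

/-- If `h` is convex univalent in `|z| < ρ`, `ρ < 1`, then `h + conj g` is univalent and
close-to-convex there as soon as `|g'| < |h'|` in the unit disk. -/
theorem isUnivalentCloseToConvexOn_add_conj {φ g : ℂ → ℂ} {ρ : ℝ} (hρ0 : 0 ≤ ρ) (hρ1 : ρ < 1)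
    (hh : DifferentiableOn ℂ h unitDisk) (hne : ∀ z ∈ unitDisk, deriv h z ≠ 0)
    (hconv : IsConvexUnivalentOn h ρ) (hφ : DifferentiableOn ℂ φ unitDisk)
    (hφm : MapsTo φ unitDisk unitDisk) (hg : DifferentiableOn ℂ g unitDisk)
    (hgφ : ∀ z ∈ unitDisk, deriv g z = φ z * deriv h z) :
    IsUnivalentCloseToConvexOn (fun z => h z + (starRingEnd ℂ) (g z)) (ball 0 ρ) := by
  rcases hρ0.eq_or_lt with rfl | hρ
  · rw [ball_zero]
    exact ⟨by simp [InnerProductSpace.HarmonicOnNhd], by simp, by simp,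
      by rw [image_empty]; exact isCloseToConvexDomain_empty⟩
  obtain ⟨hi, hc⟩ := hconv
  have hsub : ball (0 : ℂ) ρ ⊆ unitDisk := ball_subset_ball hρ1.le
  have hhρ := hh.mono hsub
  have hgρ := hg.mono hsub
  have hdh : ∀ z ∈ unitDisk, DifferentiableAt ℂ h z := fun z hz =>
    hh.differentiableAt (isOpen_ball.mem_nhds hz)
  have hdg : ∀ z ∈ unitDisk, DifferentiableAt ℂ g z := fun z hz =>
    hg.differentiableAt (isOpen_ball.mem_nhds hz)
  -- This is where `ρ < 1` matters: compactness turns `|φ| < 1` into a uniform contraction constant.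
  obtain ⟨z₀, hz₀, hmax⟩ := (isCompact_closedBall (0 : ℂ) ρ).exists_isMaxOn
    (nonempty_closedBall.2 hρ.le) (hφ.continuousOn.norm.mono (closedBall_subset_ball hρ1))
  have hk : ‖φ z₀‖₊ < 1 := by
    have := hφm (closedBall_subset_ball hρ1 hz₀)
    rwa [mem_ball_zero_iff] at this
  set v := Function.invFunOn h (ball 0 ρ) with hv
  have hvh : ∀ z ∈ ball (0 : ℂ) ρ, v (h z) = z := fun z hz => hi.leftInvOn_invFunOn hz
  have hG : ∀ z ∈ ball (0 : ℂ) ρ, HasDerivAt (g ∘ v) (φ z) (h z) := fun z hz => by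
    have h1 := hasDerivAt_invFunOn isOpen_ball hhρ hi hz (hne z (hsub hz))
    have h2 : HasDerivAt g (deriv g z) (v (h z)) := by
      rw [hvh z hz]; exact (hdg z (hsub hz)).hasDerivAt
    have h3 := h2.comp _ h1
    rwa [hgφ z (hsub hz), mul_assoc, mul_inv_cancel₀ (hne z (hsub hz)), mul_one] at h3
  have hGl : LipschitzOnWith ‖φ z₀‖₊ (g ∘ v) (h '' ball 0 ρ) := by
    refine hc.lipschitzOnWith_of_nnnorm_deriv_le ?_ ?_
    · rintro _ ⟨z, hz, rfl⟩
      exact (hG z hz).differentiableAt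
    · rintro _ ⟨z, hz, rfl⟩
      rw [(hG z hz).deriv]
      exact hmax (ball_subset_closedBall hz)
  have hT : LipschitzOnWith ‖φ z₀‖₊ (fun w => (starRingEnd ℂ) (g (v w))) (h '' ball 0 ρ) := by
    have := Complex.isometry_conj.lipschitz.comp_lipschitzOnWith hGl
    rwa [one_mul] at this
  have hΩo : IsOpen (h '' ball 0 ρ) := isOpen_iff_mem_nhds.2 <| by
    rintro _ ⟨z, hz, rfl⟩
    have hst : HasStrictDerivAt h (deriv h z) z :=
      (hhρ.analyticAt (isOpen_ball.mem_nhds hz)).hasStrictDerivAt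
    rw [← hst.map_nhds_eq (hne z (hsub hz))]
    exact image_mem_map (isOpen_ball.mem_nhds hz)
  obtain ⟨hFi, hFo, S, hS1, hSc, hSd⟩ := hc.exists_halfLines_compl_image_add_contraction hΩo
    ((nonempty_ball.2 hρ).image h) hk hT
  have hcomp : EqOn ((fun w => w + (starRingEnd ℂ) (g (v w))) ∘ h)
      (fun z => h z + (starRingEnd ℂ) (g z)) (ball 0 ρ) := fun z hz => by
    simp only [Function.comp_apply, hvh z hz]
  have himg : (fun z => h z + (starRingEnd ℂ) (g z)) '' ball 0 ρ =
      (fun w => w + (starRingEnd ℂ) (g (v w))) '' (h '' ball 0 ρ) := by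
    rw [← hcomp.image_eq, image_comp]
  refine ⟨harmonicOnNhd_add_conj isOpen_ball hhρ hgρ, ?_, ?_, ?_, ?_, S, hS1, ?_, ?_⟩
  · exact (hFi.comp hi (mapsTo_image _ _)).congr hcomp
  · intro z hz
    have hz1 := hsub hz
    rw [Complex.det_fderiv_add_conj (hdh z hz1) (hdg z hz1), hgφ z hz1, norm_mul]
    have h1 : ‖φ z‖ < 1 := mem_ball_zero_iff.1 (hφm hz1)
    have h2 : 0 < ‖deriv h z‖ := norm_pos_iff.2 (hne z hz1)
    have h3 : ‖φ z‖ * ‖deriv h z‖ < ‖deriv h z‖ := mul_lt_of_lt_one_left h2 h1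
    have h4 := pow_lt_pow_left₀ h3 (by positivity) two_ne_zero
    linarith
  · rw [himg]; exact hFo
  · refine (convex_ball (0 : ℂ) ρ).isPreconnected.image _ ?_
    exact hhρ.continuousOn.add (Complex.continuous_conj.comp_continuousOn hgρ.continuousOn)
  · rw [himg, hSc]
    simp only [closedHalfLine, Complex.real_smul]
  · simpa only [openHalfLine, Complex.real_smul] using hSd

theorem isUnivalentCloseToConvexOn_of_starlikeClass (hψ : IsMaMindaFunction ψ)
    (hh : h ∈ starlikeClass ψ) {H : ℝ → ℝ} {r₀ : ℝ} (hr₀ : IsMinimalRoot H r₀) {φ g : ℂ → ℂ}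
    (hφ : DifferentiableOn ℂ φ unitDisk) (hφm : MapsTo φ unitDisk unitDisk)
    (hg : DifferentiableOn ℂ g unitDisk) (hgφ : ∀ z ∈ unitDisk, deriv g z = φ z * deriv h z) :
    IsUnivalentCloseToConvexOn (fun z => h z + (starRingEnd ℂ) (g z))
      (ball 0 (min r₀ (radiusOfConvexity ψ))) :=
  isUnivalentCloseToConvexOn_add_conj (le_min hr₀.1.1.1.le radiusOfConvexity_nonneg)
    ((min_le_left _ _).trans_lt hr₀.1.1.2) hh.1.1 (fun _ hz => deriv_ne_zero_of_mem hψ hh hz)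
    (isConvexUnivalentOn_of_le_radiusOfConvexity hψ hh (min_le_right _ _)) hφ hφm hg hgφ

end MaMinda

theorem mainTheorem7 (ψ : ℂ → ℂ) (hψ : MaMinda.IsMaMindaFunction ψ) :
    (∃ r₀ : ℝ, MaMinda.IsMinimalRoot (MaMinda.classConvexityMin ψ) r₀ ∧
      ∀ h ∈ MaMinda.starlikeClass ψ, ∀ φ g : ℂ → ℂ,
        DifferentiableOn ℂ φ MaMinda.unitDisk →
        MapsTo φ MaMinda.unitDisk MaMinda.unitDisk →
        DifferentiableOn ℂ g MaMinda.unitDisk →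
        (∀ z ∈ MaMinda.unitDisk, deriv g z = φ z * deriv h z) →
        MaMinda.IsUnivalentCloseToConvexOn (fun z => h z + (starRingEnd ℂ) (g z))
          (ball 0 (min r₀ (MaMinda.radiusOfConvexity ψ)))) ∧
    (∀ h ∈ MaMinda.starlikeClass ψ,
      ∃ r₀ : ℝ, MaMinda.IsMinimalRoot (MaMinda.convexityMin h) r₀ ∧
      ∀ φ g : ℂ → ℂ,
        DifferentiableOn ℂ φ MaMinda.unitDisk →
        MapsTo φ MaMinda.unitDisk MaMinda.unitDisk →
        DifferentiableOn ℂ g MaMinda.unitDisk →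
        (∀ z ∈ MaMinda.unitDisk, deriv g z = φ z * deriv h z) →
        MaMinda.IsUnivalentCloseToConvexOn (fun z => h z + (starRingEnd ℂ) (g z))
          (ball 0 (min r₀ (MaMinda.radiusOfConvexity ψ)))) := by
  refine ⟨?_, fun h hh => ?_⟩
  · obtain ⟨r₀, hr₀⟩ := MaMinda.exists_isMinimalRoot_classConvexityMin hψ
    exact ⟨r₀, hr₀, fun h hh φ g hφ hφm hg hgφ =>
      MaMinda.isUnivalentCloseToConvexOn_of_starlikeClass hψ hh hr₀ hφ hφm hg hgφ⟩
  · obtain ⟨r₀, hr₀⟩ := MaMinda.exists_isMinimalRoot_convexityMin hψ hh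
    exact ⟨r₀, hr₀, fun φ g hφ hφm hg hgφ =>
      MaMinda.isUnivalentCloseToConvexOn_of_starlikeClass hψ hh hr₀ hφ hφm hg hgφ⟩
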